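/- Let $X$ be a complex Banach space and let $A$ be a densely defined linear operator in $X$ that is sectorial: there are $\rho_0>0$ and $\varphi_0\in(0,\pi/2)$ such that the spectrum of $A$ lies in $\Sigma=\{\rho_0+re^{i\theta}: r\ge 0,\ |\theta|<\varphi_0\}$ and, for some constant $M$, the resolvent $R_A(z)=(zI-A)^{-1}$ satisfies $\|R_A(z)\|\le M/(1+|z|)$ on the boundary of $\Sigma$ and outside $\Sigma$. Let $\alpha,L,c>0$, $u_0\in X$, and let $n\ge 1$, $N\ge 0$ be integers. Put $d=\frac{\pi}{2}-\varphi_0$, $h=\sqrt{\frac{\pi d}{\alpha(N+1)}}$, $a_I=\rho_0\frac{\cos(d/2+\varphi_0)}{\cos\varphi_0}$, $b_I=\rho_0\frac{\sin(d/2+\varphi_0)}{\cos\varphi_0}$, $z(s)=a_I\cosh s-ib_I\sinh s$, and $$T_N(A,t)=\frac{h}{2\pi i}\sum_{m=-N}^{N}e^{-z(mh)(t+1)}z'(mh)\Big(R_A(z(mh))-\frac{1}{z(mh)}I\Big).$$ Let $t_j=-\cos(\pi j/n)$, $j=0,\dots,n$, be the Chebyshev–Gauss–Lobatto nodes, let $B_i$,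 $i=0,\dots,n$, be the unique polynomial of degree at most $2n-1$ with $B_i(t_j)=\delta_{ij}$ for $0\le j\le n$ and $B_i'(t_j)=0$ for $1\le j\le n-1$, and for $\vec y=(y_0,\dots,y_n)\in X^{n+1}$ let $K(t,\vec y)=\sum_{i=0}^nB_i(t)y_i$ be the modified Hermite–Fejér polynomial. Suppose that $g:C([-1,1];X)\to X$ satisfies, for all $u,v\in C([-1,1];X)$, $g(u)-g(v)\in D(A^\alpha)$ and $$\|A^\alpha(g(u)-g(v))\|\le L\max_{t\in[-1,1]}\|u(t)-v(t)\|,$$ and that $c$ is a constant with $\|T_N(A,t_i)A^{-\alpha}\|\le c/\alpha$ for $i=0,\dots,n$. Put $\vec g(\vec y)=\big(T_N(A,t_i)\,g(K(\cdot,\vec y))\big)_{i=0}^n$, $\vec p=\big(T_N(A,t_i)u_0\big)_{i=0}^n$, $\vec y^{(0)}=\vec p$, $\vec y^{(k)}=\vec g(\vec y^{(k-1)})+\vec p$ for $k\ge1$, and $|||\vec x|||=\max_{0\le j\le n}\|x_j\|$. If $q:=3Lc/\alpha<1$, then the system $\vec y=\vec g(\vec y)+\vec p$ has a unique solution $\vec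 y^{(\infty)}\in X^{n+1}$, and $\vec y^{(\infty)}=\lim_{k\to\infty}\vec y^{(k)}$. Moreover, $$|||\vec y^{(\infty)}|||\le|||\vec p|||+\frac{|||\vec g(\vec p)|||}{1-q},\qquad |||\vec y^{(\infty)}-\vec y^{(k)}|||\le|||\vec g(\vec p)|||\,\frac{q^{k}}{1-q}\quad(k=0,1,2,\dots).$$ -/

import Mathlib

noncomputable section

namespace NonlocalCauchy

/-! ### Sectorial operators -/

section Operator

variable {X : Type*} [NormedAddCommGroup X] [NormedSpace ℂ X]

/-- The bounded operator `R` is the inverse of `z I - A : D(A) → X`. -/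
def IsResolventAt (A : X →ₗ.[ℂ] X) (z : ℂ) (R : X →L[ℂ] X) : Prop :=
  (∀ x : X, ∃ h : R x ∈ A.domain, z • R x - A ⟨R x, h⟩ = x) ∧
    ∀ x : A.domain, R (z • (x : X) - A x) = x

theorem IsResolventAt.unique {A : X →ₗ.[ℂ] X} {z : ℂ} {R S : X →L[ℂ] X}
    (hR : IsResolventAt A z R) (hS : IsResolventAt A z S) : R = S := by
  ext x
  obtain ⟨h, hx⟩ := hS.1 x
  have := hR.2 ⟨S x, h⟩
  simpa [hx] using this

/-- The resolvent set of `A`. -/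
def resolventSet (A : X →ₗ.[ℂ] X) : Set ℂ := {z | ∃ R, IsResolventAt A z R}

/-- The spectrum of the (possibly unbounded) operator `A`. -/
def opSpectrum (A : X →ₗ.[ℂ] X) : Set ℂ := (resolventSet A)ᶜ

open Classical in
/-- The resolvent `R_A(z) = (z I - A)⁻¹`, for `z` in the resolvent set of `A`
(and `0` elsewhere). -/
def resolventOp (A : X →ₗ.[ℂ] X) (z : ℂ) : X →L[ℂ] X :=
  if h : ∃ R, IsResolventAt A z R then h.choose else 0

theorem IsResolventAt.resolventOp_eq {A : X →ₗ.[ℂ] X} {z : ℂ} {R : X →L[ℂ] X}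
    (hR : IsResolventAt A z R) : resolventOp A z = R := by
  have h : ∃ R, IsResolventAt A z R := ⟨R, hR⟩
  rw [resolventOp, dif_pos h]
  exact h.choose_spec.unique hR

/-- The sector `Σ(ρ, φ) = {ρ + r e^{iθ} : r ≥ 0, |θ| < φ}`. -/
def sector (ρ φ : ℝ) : Set ℂ :=
  {z | ∃ r θ : ℝ, 0 ≤ r ∧ |θ| < φ ∧ z = ρ + r * Complex.exp (Complex.I * θ)}

/-- `A` is sectorial with the sector `Σ(ρ, φ)`, `ρ > 0`, `0 < φ < π/2`: the spectrum of `A` lies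
in the sector, and `‖R_A(z)‖ ≤ M / (1 + |z|)` on the boundary of the sector and outside it. -/
structure IsSectorial (A : X →ₗ.[ℂ] X) (ρ φ : ℝ) : Prop where
  rho_pos : 0 < ρ
  phi_pos : 0 < φ
  phi_lt : φ < Real.pi / 2
  spectrum_subset : opSpectrum A ⊆ sector ρ φ
  resolvent_bound : ∃ M : ℝ, ∀ z ∈ frontier (sector ρ φ) ∪ (sector ρ φ)ᶜ,
    z ∈ resolventSet A ∧ ‖resolventOp A z‖ ≤ M / (1 + ‖z‖)

/-! ### Fractional powers -/

/-- The negative fractional power `A^{-α}`, `α > 0`, by the Balakrishnan–Komatsu formula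
`A^{-α} = Γ(m) / (Γ(α) Γ(m - α)) ∫_0^∞ s^{m-α-1} ((s I + A)⁻¹)^m ds` with `m = ⌊α⌋ + 1`, where
`(s I + A)⁻¹ = -R_A(-s)`. -/
def fracPowNeg (A : X →ₗ.[ℂ] X) (α : ℝ) : X →L[ℂ] X :=
  let m : ℕ := ⌊α⌋₊ + 1
  (Real.Gamma m / (Real.Gamma α * Real.Gamma (m - α))) •
    ∫ s in Set.Ioi (0 : ℝ), s ^ ((m : ℝ) - α - 1) • (-resolventOp A (-(s : ℂ))) ^ m

/-- The graph of the positive fractional power `A^α = (A^{-α})⁻¹`, `α > 0`, whose domain is the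
range of `A^{-α}`: `x ∈ D(A^α)` and `A^α x = w`. -/
def IsFracPow (A : X →ₗ.[ℂ] X) (α : ℝ) (x w : X) : Prop :=
  fracPowNeg A α w = x

/-! ### The Sinc quadrature for the operator exponential -/

/-- The width `d = π/2 - φ` of the strip of analyticity. -/
def stripWidth (φ : ℝ) : ℝ := Real.pi / 2 - φ

/-- The parameter `a_I` of the integration hyperbola. -/
def contourA (ρ φ : ℝ) : ℝ := ρ * Real.cos (stripWidth φ / 2 + φ) / Real.cos φ

/-- The parameter `b_I` of the integration hyperbola. -/
def contourB (ρ φ : ℝ) : ℝ := ρ * Real.sin (stripWidth φ / 2 + φ) / Real.cos φ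

/-- The integration hyperbola `z(s) = a_I cosh s - i b_I sinh s`. -/
def contour (ρ φ s : ℝ) : ℂ :=
  contourA ρ φ * Real.cosh s - Complex.I * contourB ρ φ * Real.sinh s

/-- The derivative `z'(s) = a_I sinh s - i b_I cosh s` of the parametrization. -/
def contourDeriv (ρ φ s : ℝ) : ℂ :=
  contourA ρ φ * Real.sinh s - Complex.I * contourB ρ φ * Real.cosh s

/-- The corrected resolvent `R_{A,1}(z) = R_A(z) - (1/z) I`. -/
def correctedResolvent (A : X →ₗ.[ℂ] X) (z : ℂ) : X →L[ℂ] X :=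
  resolventOp A z - (1 / z) • ContinuousLinearMap.id ℂ X

/-- The step `h = √(π d / (α (N + 1)))` of the quadrature. -/
def sincStep (φ α : ℝ) (N : ℕ) : ℝ := √(Real.pi * stripWidth φ / (α * (N + 1)))

/-- The Sinc quadrature
`T_N(A, t) = h / (2 π i) ∑_{p = -N}^N e^{-z(p h) (t + 1)} z'(p h) R_{A,1}(z(p h))`. -/
def sincExp (A : X →ₗ.[ℂ] X) (ρ φ α : ℝ) (N : ℕ) (t : ℝ) : X →L[ℂ] X :=
  let h : ℝ := sincStep φ α N
  ((h : ℂ) / (2 * Real.pi * Complex.I)) • ∑ p ∈ Finset.Icc (-(N : ℤ)) N,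
    (Complex.exp (-contour ρ φ (p * h) * (t + 1)) * contourDeriv ρ φ (p * h)) •
      correctedResolvent A (contour ρ φ (p * h))

end Operator

/-! ### Modified Hermite–Fejér interpolation -/

/-- The Chebyshev–Gauss–Lobatto nodes `t_j = -cos(π j / n)`, `j = 0, …, n`. -/
def node (n j : ℕ) : ℝ := -Real.cos (Real.pi * j / n)

/-- `p` is the `i`-th fundamental polynomial of modified Hermite–Fejér interpolation: its degree is
at most `2n - 1`, `p(t_j) = δ_{ij}` for `0 ≤ j ≤ n`, and `p'(t_j) = 0` for `1 ≤ j ≤ n - 1`. -/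
def IsHermiteFejerBasis (n i : ℕ) (p : Polynomial ℝ) : Prop :=
  p.degree < (2 * n : ℕ) ∧
    (∀ j ≤ n, p.eval (node n j) = if j = i then 1 else 0) ∧
    ∀ j, 1 ≤ j → j < n → p.derivative.eval (node n j) = 0

theorem node_injOn (n : ℕ) : Set.InjOn (node n) {j | j ≤ n} := by
  intro i hi j hj hij
  rcases Nat.eq_zero_or_pos n with rfl | hn
  · exact (Nat.le_zero.mp hi).trans (Nat.le_zero.mp hj).symm
  have hn' : (0 : ℝ) < n := by exact_mod_cast hn
  have mem : ∀ k : ℕ, k ≤ n → Real.pi * k / n ∈ Set.Icc 0 Real.pi := by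
    intro k hk
    have hk' : (k : ℝ) ≤ n := by exact_mod_cast hk
    refine ⟨by positivity, ?_⟩
    rw [div_le_iff₀ hn']
    exact mul_le_mul_of_nonneg_left hk' Real.pi_pos.le
  have h := Real.strictAntiOn_cos.injOn (mem i hi) (mem j hj) (neg_injective hij)
  field_simp at h
  exact_mod_cast h

/-- A polynomial of degree less than `2n` vanishes if it vanishes at all the nodes and its
derivative vanishes at the interior nodes. -/
theorem eq_zero_of_nodes {n : ℕ} (hn : 1 ≤ n) {p : Polynomial ℝ} (hd : p.degree < (2 * n : ℕ))
    (h0 : ∀ j ≤ n, p.eval (node n j) = 0)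
    (h1 : ∀ j, 1 ≤ j → j < n → p.derivative.eval (node n j) = 0) : p = 0 := by
  by_contra hp
  let m : ℕ → ℕ := fun j => if 1 ≤ j ∧ j < n then 2 else 1
  have hdvd : ∏ j ∈ Finset.range (n + 1),
      (Polynomial.X - Polynomial.C (node n j)) ^ m j ∣ p := by
    apply Finset.prod_dvd_of_coprime
    · intro i hi j hj hij
      apply IsCoprime.pow
      apply Polynomial.isCoprime_X_sub_C_of_isUnit_sub
      rw [isUnit_iff_ne_zero, sub_ne_zero]
      intro h
      simp only [Finset.coe_range, Set.mem_Iio] at hi hj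
      exact hij (node_injOn n (Nat.lt_succ_iff.mp hi) (Nat.lt_succ_iff.mp hj) h)
    · intro j hj
      have hj' : j ≤ n := Nat.lt_succ_iff.mp (Finset.mem_range.mp hj)
      rw [← Polynomial.le_rootMultiplicity_iff hp]
      by_cases hm : 1 ≤ j ∧ j < n
      · have := (Polynomial.one_lt_rootMultiplicity_iff_isRoot hp).2
          ⟨h0 j hj', h1 j hm.1 hm.2⟩
        simp only [m, if_pos hm]
        exact this
      · have := (Polynomial.rootMultiplicity_pos hp).2 (h0 j hj')
        simp only [m, if_neg hm]
        exact this
  have hle := Polynomial.degree_le_of_dvd hdvd hp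
  have hdeg : (∏ j ∈ Finset.range (n + 1),
      (Polynomial.X - Polynomial.C (node n j)) ^ m j).degree = ((2 * n : ℕ) : WithBot ℕ) := by
    have hsum : ∑ j ∈ Finset.range (n + 1), m j = 2 * n := by
      obtain ⟨k, rfl⟩ : ∃ k, n = k + 1 := ⟨n - 1, by omega⟩
      rw [Finset.sum_range_succ, Finset.sum_range_succ']
      have : ∀ j ∈ Finset.range k, m (j + 1) = 2 := by
        intro j hj
        have := Finset.mem_range.mp hj
        simp only [m]
        rw [if_pos (by omega)]
      rw [Finset.sum_congr rfl this]
      simp [m]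
      omega
    rw [Polynomial.degree_prod]
    simp only [Polynomial.degree_pow, Polynomial.degree_X_sub_C, nsmul_eq_mul, mul_one]
    rw [← hsum]
    push_cast
    rfl
  rw [hdeg] at hle
  exact absurd hd (not_lt.mpr hle)

theorem existsUnique_hermiteFejerBasis {n : ℕ} (hn : 1 ≤ n) (i : ℕ) :
    ∃! p, IsHermiteFejerBasis n i p := by
  obtain ⟨k, rfl⟩ : ∃ k, n = k + 1 := ⟨n - 1, by omega⟩
  let Φ : Polynomial ℝ →ₗ[ℝ] (Fin (k + 2) ⊕ Fin k → ℝ) :=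
    LinearMap.pi (Sum.elim (fun j => Polynomial.leval (node (k + 1) j))
      (fun j => Polynomial.leval (node (k + 1) (j + 1)) ∘ₗ Polynomial.derivative))
  let Ψ := Φ.domRestrict (Polynomial.degreeLT ℝ (2 * (k + 1)))
  have hinj : Function.Injective Ψ := by
    rw [injective_iff_map_eq_zero]
    rintro ⟨p, hp⟩ h
    rw [Polynomial.mem_degreeLT] at hp
    have h' : Φ p = 0 := h
    ext1
    refine eq_zero_of_nodes hn hp ?_ ?_
    · intro j hj
      exact congrFun h' (Sum.inl ⟨j, by omega⟩)
    · intro j hj1 hj2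
      have := congrFun h' (Sum.inr ⟨j - 1, by omega⟩)
      simpa [Φ, Nat.sub_add_cancel hj1, Polynomial.leval] using
        (show (Polynomial.derivative p).eval (node (k + 1) (j - 1 + 1)) = 0 from this)
  have : FiniteDimensional ℝ (Polynomial.degreeLT ℝ (2 * (k + 1))) :=
    LinearEquiv.finiteDimensional (Polynomial.degreeLTEquiv ℝ (2 * (k + 1))).symm
  have hsurj : Function.Surjective Ψ := by
    rw [← LinearMap.injective_iff_surjective_of_finrank_eq_finrank]
    · exact hinj
    · rw [(Polynomial.degreeLTEquiv ℝ (2 * (k + 1))).finrank_eq]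
      simp
      omega
  obtain ⟨⟨p, hp⟩, hpΨ⟩ := hsurj (Sum.elim (fun j => if (j : ℕ) = i then 1 else 0) (fun _ => 0))
  rw [Polynomial.mem_degreeLT] at hp
  refine ⟨p, ⟨hp, ?_, ?_⟩, ?_⟩
  · intro j hj
    exact congrFun hpΨ (Sum.inl ⟨j, by omega⟩)
  · intro j hj1 hj2
    have := congrFun hpΨ (Sum.inr ⟨j - 1, by omega⟩)
    simpa [Nat.sub_add_cancel hj1] using
      (show (Polynomial.derivative p).eval (node (k + 1) (j - 1 + 1)) = 0 from this)
  · rintro r ⟨hr, hr0, hr1⟩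
    rw [← sub_eq_zero]
    refine eq_zero_of_nodes hn (lt_of_le_of_lt (Polynomial.degree_sub_le _ _) (max_lt hr hp)) ?_ ?_
    · intro j hj
      have := congrFun hpΨ (Sum.inl ⟨j, by omega⟩)
      have h2 : p.eval (node (k + 1) j) = if j = i then 1 else 0 := this
      rw [Polynomial.eval_sub, hr0 j hj, h2, sub_self]
    · intro j hj1 hj2
      have := congrFun hpΨ (Sum.inr ⟨j - 1, by omega⟩)
      have h2 : (Polynomial.derivative p).eval (node (k + 1) (j - 1 + 1)) = 0 := this
      rw [Nat.sub_add_cancel hj1] at h2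
      rw [Polynomial.derivative_sub, Polynomial.eval_sub, hr1 j hj1 hj2, h2, sub_self]

open Classical in
/-- The fundamental polynomial `B_{i,2n-1}`: for `n ≥ 1`, the unique polynomial with the defining
property `IsHermiteFejerBasis n i`. -/
def hermiteFejerBasis (n i : ℕ) : Polynomial ℝ :=
  if h : ∃ p, IsHermiteFejerBasis n i p then h.choose else 0

theorem hermiteFejerBasis_spec {n : ℕ} (hn : 1 ≤ n) (i : ℕ) :
    IsHermiteFejerBasis n i (hermiteFejerBasis n i) := by
  have h := (existsUnique_hermiteFejerBasis hn i).exists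
  rw [hermiteFejerBasis, dif_pos h]
  exact h.choose_spec

section Scheme

variable {X : Type*} [NormedAddCommGroup X] [NormedSpace ℂ X]

/-- The modified Hermite–Fejér polynomial `K_{2n-1}(t, y) = ∑_{i=0}^n B_{i,2n-1}(t) y_i`, as an
element of `C([-1, 1]; X)`. -/
def hermiteFejer (n : ℕ) (y : Fin (n + 1) → X) : C(Set.Icc (-1 : ℝ) 1, X) where
  toFun t := ∑ i : Fin (n + 1), (((hermiteFejerBasis n i).eval (t : ℝ) : ℝ) : ℂ) • y i
  continuous_toFun := by
    refine continuous_finsetSum _ fun i _ => Continuous.smul ?_ continuous_const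
    exact Complex.continuous_ofReal.comp
      ((hermiteFejerBasis n i).continuous.comp continuous_subtype_val)

/-! ### The discretized Hammerstein equation -/

/-- The nonlinear part of the collocated system, with the components
`T_N(A, t_i) g(K_{2n-1}(·, y))`, `i = 0, …, n`. -/
def discreteG (A : X →ₗ.[ℂ] X) (ρ φ α : ℝ) (N n : ℕ) (g : C(Set.Icc (-1 : ℝ) 1, X) → X)
    (y : Fin (n + 1) → X) : Fin (n + 1) → X :=
  fun i => sincExp A ρ φ α N (node n i) (g (hermiteFejer n y))

/-- The vector `p` with the components `T_N(A, t_i) u₀`, `i = 0, …, n`. -/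
def discreteP (A : X →ₗ.[ℂ] X) (ρ φ α : ℝ) (N n : ℕ) (u₀ : X) : Fin (n + 1) → X :=
  fun i => sincExp A ρ φ α N (node n i) u₀

/-- The fixed-point iterates `y^{(0)} = p`, `y^{(k)} = G(y^{(k-1)}) + p` of a map `G`. -/
def iterate {V : Type*} [Add V] (G : V → V) (p : V) : ℕ → V
  | 0 => p
  | k + 1 => G (iterate G p k) + p

end Scheme

end NonlocalCauchy

end

/-!
The map `y ↦ G y + p` is a contraction of `X^{n+1}` with constant `q`, so everything follows from
Banach's fixed-point theorem with its a priori error estimate.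

For the contraction property, write `g(u) - g(v) = A^{-α} w` with `‖w‖ ≤ L ‖u - v‖`. Then
`T_N(A, t_i) (g(u) - g(v)) = (T_N(A, t_i) A^{-α}) w` has norm at most `(c / α) L ‖u - v‖`, and it
remains to bound `‖K(·, y) - K(·, y')‖` by `3 ‖y - y'‖`. In fact the Lebesgue constant of modified
Hermite–Fejér interpolation at the Chebyshev–Gauss–Lobatto nodes is `1`
(`norm_hermiteFejer_le`): the fundamental polynomials sum to `1`
(`sum_hermiteFejerBasis`) and are nonnegative on `[-1, 1]` (`hermiteFejerBasis_eval_nonneg`).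

Nonnegativity is read off from explicit formulas. The interior nodes are the zeros of the Chebyshev
polynomial `U = U_{n-1}`. Up to positive factors, the fundamental polynomials of the end points
`±1` are `(1 ± x) U(x)²`, and that of the interior node `ξ` is
`(1 - x²) (1 - ξ x) (U(x) / (x - ξ))²`; its derivative vanishes at `ξ` because of the
differential equation `(1 - x²) U'' - 3 x U' + (n² - 1) U = 0`.
-/

noncomputable section

open Polynomial

namespace NonlocalCauchy

/-! ### The nodes and the Chebyshev polynomials of the second kind -/

theorem node_zero (n : ℕ) : node n 0 = -1 := by
  simp [node]

theorem node_self {n : ℕ} (hn : 1 ≤ n) : node n n = 1 := by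
  have : (n : ℝ) ≠ 0 := by positivity
  simp [node, this]

theorem node_mem_Ioo {n j : ℕ} (hj1 : 1 ≤ j) (hj2 : j < n) : node n j ∈ Set.Ioo (-1 : ℝ) 1 := by
  have hn : (0 : ℝ) < n := by exact_mod_cast (by omega : 0 < n)
  have hj1' : (0 : ℝ) < j := by exact_mod_cast hj1
  have hj2' : (j : ℝ) < n := by exact_mod_cast hj2
  have h0 : 0 < Real.pi * j / n := by positivity
  have h1 : Real.pi * j / n < Real.pi := by
    rw [div_lt_iff₀ hn]
    exact mul_lt_mul_of_pos_left hj2' Real.pi_pos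
  have hl := Real.strictAntiOn_cos (Set.left_mem_Icc.2 Real.pi_pos.le) ⟨h0.le, h1.le⟩ h0
  have hr := Real.strictAntiOn_cos ⟨h0.le, h1.le⟩ (Set.right_mem_Icc.2 Real.pi_pos.le) h1
  rw [Real.cos_zero] at hl
  rw [Real.cos_pi] at hr
  constructor <;> simp only [node] <;> linarith

theorem eval_U_node {m j : ℕ} (hj1 : 1 ≤ j) (hj2 : j < m + 1) :
    (Chebyshev.U ℝ m).eval (node (m + 1) j) = 0 := by
  have hmem := node_mem_Ioo hj1 hj2
  have hm : ((m : ℝ) + 1) ≠ 0 := by positivity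
  set θ : ℝ := Real.pi - Real.pi * j / (m + 1 : ℕ)
  have hcos : node (m + 1) j = Real.cos θ := (Real.cos_pi_sub _).symm
  have hsin : Real.sin θ ≠ 0 := by
    intro h
    have h1 := Real.sin_sq_add_cos_sq θ
    rw [h, ← hcos] at h1
    nlinarith [hmem.1, hmem.2]
  have h := Chebyshev.U_real_cos θ (m : ℤ)
  have hθ : (((m : ℤ) : ℝ) + 1) * θ = ((m + 1 - j : ℕ) : ℝ) * Real.pi := by
    rw [Nat.cast_sub hj2.le]
    simp only [θ]
    push_cast
    field_simp
  rw [hθ, Real.sin_nat_mul_pi] at h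
  rw [hcos]
  exact (mul_eq_zero.1 h).resolve_right hsin

/-- The zeros of `U_m` are simple. -/
theorem eval_derivative_U_ne_zero {m : ℕ} {x : ℝ} (hx : (Chebyshev.U ℝ m).eval x = 0) :
    (Chebyshev.U ℝ m).derivative.eval x ≠ 0 := by
  intro h
  have h0 : Chebyshev.U ℝ (m : ℤ) ≠ 0 := by
    intro h0
    have := Chebyshev.degree_U_natCast ℝ m
    simp [h0] at this
  have h1 := (one_lt_rootMultiplicity_iff_isRoot h0).2 ⟨hx, h⟩
  have h2 : (Chebyshev.U ℝ (m : ℤ)).roots.Nodup := by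
    rw [Chebyshev.roots_U_real]
    exact Finset.nodup _
  have h3 := Multiset.nodup_iff_count_le_one.1 h2 x
  rw [count_roots] at h3
  omega

/-- The differential equation of `U_m` at a zero of `U_m`. -/
theorem one_sub_sq_mul_eval_derivative_derivative_U {m : ℕ} {x : ℝ}
    (hx : (Chebyshev.U ℝ m).eval x = 0) :
    (1 - x ^ 2) * (Chebyshev.U ℝ m).derivative.derivative.eval x =
      3 * x * (Chebyshev.U ℝ m).derivative.eval x := by
  have h := congrArg (eval x)
    (Chebyshev.one_sub_X_sq_mul_derivative_derivative_U_eq_poly_in_U (R := ℝ) m)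
  simpa [hx] using h

/-! ### Nonnegativity of the fundamental polynomials -/

/-- A polynomial with the defining property of a fundamental polynomial up to a positive factor
determines the sign of that fundamental polynomial. -/
theorem hermiteFejerBasis_eval_nonneg_of_multiple {n i : ℕ} (hn : 1 ≤ n) {P : ℝ[X]}
    (hd : P.degree < (2 * n : ℕ)) (hi : 0 < P.eval (node n i))
    (h0 : ∀ j ≤ n, j ≠ i → P.eval (node n j) = 0)
    (h1 : ∀ j, 1 ≤ j → j < n → P.derivative.eval (node n j) = 0)
    {x : ℝ} (hx : 0 ≤ P.eval x) : 0 ≤ (hermiteFejerBasis n i).eval x := by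
  have hP : IsHermiteFejerBasis n i (C (P.eval (node n i))⁻¹ * P) := by
    refine ⟨?_, fun j hj => ?_, fun j hj1 hj2 => ?_⟩
    · rwa [degree_C_mul (inv_ne_zero hi.ne')]
    · rw [eval_C_mul]
      split_ifs with hji
      · rw [hji, inv_mul_cancel₀ hi.ne']
      · rw [h0 j hj hji, mul_zero]
    · rw [derivative_C_mul, eval_C_mul, h1 j hj1 hj2, mul_zero]
  rw [(existsUnique_hermiteFejerBasis hn i).unique (hermiteFejerBasis_spec hn i) hP, eval_C_mul]
  exact mul_nonneg (inv_nonneg.2 hi.le) hx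

theorem degree_lt_two_mul_succ {m : ℕ} {P : ℝ[X]} (h : P.natDegree ≤ 2 * m + 1) :
    P.degree < (2 * (m + 1) : ℕ) :=
  degree_le_natDegree.trans_lt (by exact_mod_cast (by omega : P.natDegree < 2 * (m + 1)))

theorem hermiteFejerBasis_eval_nonneg_of_endpoint {n i : ℕ} (hn : 1 ≤ n) (hi : i = 0 ∨ i = n)
    {x : ℝ} (hx : x ∈ Set.Icc (-1 : ℝ) 1) : 0 ≤ (hermiteFejerBasis n i).eval x := by
  obtain ⟨m, rfl⟩ : ∃ m, n = m + 1 := ⟨n - 1, by omega⟩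
  set U := Chebyshev.U ℝ (m : ℤ) with hU
  set σ := node (m + 1) i with hσ
  have hnode : σ = -1 ∨ σ = 1 := by
    rcases hi with rfl | rfl
    · exact Or.inl (node_zero _)
    · exact Or.inr (node_self hn)
  -- `P` has double zeros at the interior nodes and a simple zero at the end point `-σ`.
  refine hermiteFejerBasis_eval_nonneg_of_multiple hn (P := (1 + C σ * X) * U ^ 2)
    (degree_lt_two_mul_succ ?_) ?_ ?_ ?_ ?_
  · have h1 : (1 + C σ * X : ℝ[X]).natDegree ≤ 1 := by compute_degree
    have h2 : (U ^ 2).natDegree ≤ 2 * m :=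
      natDegree_pow_le_of_le 2 (Chebyshev.natDegree_U_natCast ℝ m).le
    exact (natDegree_mul_le_of_le h1 h2).trans (by omega)
  · have hm : ((m : ℝ) + 1) ≠ 0 := by positivity
    have hUσ : U.eval σ ≠ 0 := by
      rcases hnode with h | h <;> rw [h, hU]
      · rw [Chebyshev.U_eval_neg_one]
        exact mul_ne_zero (by rcases Int.even_or_odd (m : ℤ) with h | h <;>
          simp [Int.negOnePow_even, Int.negOnePow_odd, h]) (by exact_mod_cast hm)
      · rw [Chebyshev.U_eval_one]
        exact_mod_cast hm
    have h2 : 1 + σ * σ = 2 := by rcases hnode with h | h <;> rw [h] <;> norm_num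
    rw [← hσ]
    simp only [eval_mul, eval_add, eval_one, eval_C, eval_X, eval_pow, h2]
    positivity
  · intro j hj hji
    by_cases hend : 1 ≤ j ∧ j < m + 1
    · simp [hU, eval_U_node hend.1 hend.2]
    · have h : 1 + σ * node (m + 1) j = 0 := by
        rcases hi with rfl | rfl
        · obtain rfl : j = m + 1 := by omega
          rw [hσ, node_zero, node_self hn]; norm_num
        · obtain rfl : j = 0 := by omega
          rw [hσ, node_zero, node_self hn]; norm_num
      simp [h]
  · intro j hj1 hj2
    simp [derivative_pow, hU, eval_U_node hj1 hj2]
  · have h : 0 ≤ 1 + σ * x := by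
      rcases hnode with h | h <;> rw [h] <;> linarith [hx.1, hx.2]
    simp only [eval_mul, eval_add, eval_one, eval_C, eval_X, eval_pow]
    positivity

theorem hermiteFejerBasis_eval_nonneg_of_interior {n i : ℕ} (hi1 : 1 ≤ i) (hi2 : i < n)
    {x : ℝ} (hx : x ∈ Set.Icc (-1 : ℝ) 1) : 0 ≤ (hermiteFejerBasis n i).eval x := by
  obtain ⟨m, rfl⟩ : ∃ m, n = m + 1 := ⟨n - 1, by omega⟩
  set U := Chebyshev.U ℝ (m : ℤ) with hU
  set ξ := node (m + 1) i with hξ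
  have hξ1 : ξ ∈ Set.Ioo (-1 : ℝ) 1 := node_mem_Ioo hi1 hi2
  have hUξ : U.eval ξ = 0 := eval_U_node hi1 hi2
  obtain ⟨V, hV⟩ : X - C ξ ∣ U := dvd_iff_isRoot.2 hUξ
  have hV0 : V ≠ 0 := by
    rintro rfl
    have := Chebyshev.degree_U_natCast ℝ m
    rw [← hU, hV] at this
    simp at this
  have hVdeg : V.natDegree + 1 = m := by
    have := Chebyshev.natDegree_U_natCast ℝ m
    rw [← hU, hV, natDegree_mul (X_sub_C_ne_zero ξ) hV0, natDegree_X_sub_C] at this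
    omega
  have hV1 : U.derivative.eval ξ = V.eval ξ := by simp [hV]
  have hV2 : U.derivative.derivative.eval ξ = 2 * V.derivative.eval ξ := by simp [hV]; ring
  have hVξ : V.eval ξ ≠ 0 := hV1 ▸ eval_derivative_U_ne_zero hUξ
  have hode := one_sub_sq_mul_eval_derivative_derivative_U hUξ
  rw [← hU, hV1, hV2] at hode
  have hVj : ∀ j, 1 ≤ j → j < m + 1 → j ≠ i → V.eval (node (m + 1) j) = 0 := by
    intro j hj1 hj2 hji
    have h := eval_U_node hj1 hj2
    rw [← hU, hV, eval_mul, eval_sub, eval_X, eval_C] at h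
    exact (mul_eq_zero.1 h).resolve_left
      (sub_ne_zero.2 fun h => hji (node_injOn _ hj2.le hi2.le h))
  have hpos : 0 < 1 - ξ ^ 2 := by nlinarith [hξ1.1, hξ1.2]
  -- The factor `1 - ξ X` is what makes the derivative of `P` vanish at `ξ`.
  refine hermiteFejerBasis_eval_nonneg_of_multiple (by omega)
    (P := (1 - X ^ 2) * (1 - C ξ * X) * V ^ 2) (degree_lt_two_mul_succ ?_) ?_ ?_ ?_ ?_
  · have h1 : ((1 - X ^ 2) * (1 - C ξ * X) : ℝ[X]).natDegree ≤ 3 := by compute_degree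
    have h2 : (V ^ 2).natDegree ≤ 2 * V.natDegree := natDegree_pow_le
    exact (natDegree_mul_le_of_le h1 h2).trans (by omega)
  · rw [← hξ]
    simp only [eval_mul, eval_sub, eval_one, eval_C, eval_X, eval_pow, ← sq]
    positivity
  · intro j hj hji
    by_cases hend : 1 ≤ j ∧ j < m + 1
    · simp [hVj j hend.1 hend.2 hji]
    · obtain rfl | rfl : j = 0 ∨ j = m + 1 := by omega
      · simp [node_zero]
      · simp [node_self]
  · intro j hj1 hj2
    by_cases hji : j = i
    · rw [hji, ← hξ]
      simp only [derivative_mul, derivative_sub, derivative_one, derivative_pow,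
        derivative_C, derivative_X, eval_mul, eval_add, eval_sub, eval_one, eval_C, eval_X,
        eval_pow, eval_zero]
      norm_num
      -- Up to the factor `(1 - ξ²) V(ξ)` this is the differential equation of `U` at `ξ`.
      linear_combination (1 - ξ ^ 2) * V.eval ξ * hode
    · simp [derivative_pow, hVj j hj1 hj2 hji]
  · have h1 : 0 ≤ 1 - x ^ 2 := by nlinarith [hx.1, hx.2]
    have h2 : 0 ≤ 1 - ξ * x := by nlinarith [hx.1, hx.2, hξ1.1, hξ1.2]
    simp only [eval_mul, eval_sub, eval_one, eval_C, eval_X, eval_pow]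
    positivity

theorem hermiteFejerBasis_eval_nonneg {n i : ℕ} (hn : 1 ≤ n) (hi : i ≤ n) {x : ℝ}
    (hx : x ∈ Set.Icc (-1 : ℝ) 1) : 0 ≤ (hermiteFejerBasis n i).eval x := by
  by_cases hend : 1 ≤ i ∧ i < n
  · exact hermiteFejerBasis_eval_nonneg_of_interior hend.1 hend.2 hx
  · exact hermiteFejerBasis_eval_nonneg_of_endpoint hn (by omega) hx

/-! ### The Lebesgue constant -/

theorem sum_hermiteFejerBasis {n : ℕ} (hn : 1 ≤ n) :
    ∑ i : Fin (n + 1), hermiteFejerBasis n i = 1 := by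
  have hB : ∀ i : Fin (n + 1), IsHermiteFejerBasis n i (hermiteFejerBasis n i) :=
    fun i => hermiteFejerBasis_spec hn i
  rw [← sub_eq_zero]
  refine eq_zero_of_nodes hn ?_ ?_ ?_
  · rw [← mem_degreeLT]
    refine Submodule.sub_mem _ (Submodule.sum_mem _ fun i _ => mem_degreeLT.2 (hB i).1)
      (mem_degreeLT.2 ?_)
    rw [degree_one]
    exact_mod_cast (by omega : 0 < 2 * n)
  · intro j hj
    rw [eval_sub, eval_finsetSum, eval_one, sub_eq_zero,
      Finset.sum_congr rfl fun i _ => (hB i).2.1 j hj,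
      Finset.sum_eq_single (⟨j, by omega⟩ : Fin (n + 1))]
    · simp
    · intro i _ hi
      exact if_neg fun h => hi (Fin.ext h.symm)
    · simp
  · intro j hj1 hj2
    rw [derivative_sub, derivative_sum, derivative_one, sub_zero, eval_finsetSum]
    exact Finset.sum_eq_zero fun i _ => (hB i).2.2 j hj1 hj2

section Scheme

variable {X : Type*} [NormedAddCommGroup X] [NormedSpace ℂ X]

/-- Modified Hermite–Fejér interpolation has Lebesgue constant `1`. -/
theorem norm_hermiteFejer_le {n : ℕ} (hn : 1 ≤ n) (y : Fin (n + 1) → X) :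
    ‖hermiteFejer n y‖ ≤ ‖y‖ := by
  refine (ContinuousMap.norm_le _ (norm_nonneg y)).2 fun t => ?_
  have hsum : ∑ i : Fin (n + 1), (hermiteFejerBasis n i).eval (t : ℝ) = 1 := by
    rw [← eval_finsetSum, sum_hermiteFejerBasis hn, eval_one]
  calc ‖∑ i : Fin (n + 1), (((hermiteFejerBasis n i).eval (t : ℝ) : ℝ) : ℂ) • y i‖
      ≤ ∑ i : Fin (n + 1), (hermiteFejerBasis n i).eval (t : ℝ) * ‖y‖ := by
        refine norm_sum_le_of_le _ fun i _ => ?_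
        have hnonneg := hermiteFejerBasis_eval_nonneg hn (Nat.lt_succ_iff.1 i.2) t.2
        rw [norm_smul, Complex.norm_real, Real.norm_of_nonneg hnonneg]
        exact mul_le_mul_of_nonneg_left (norm_le_pi_norm y i) hnonneg
    _ = ‖y‖ := by rw [← Finset.sum_mul, hsum, one_mul]

theorem hermiteFejer_sub (n : ℕ) (x y : Fin (n + 1) → X) :
    hermiteFejer n x - hermiteFejer n y = hermiteFejer n (x - y) := by
  ext t
  simp [hermiteFejer, smul_sub]

/-! ### The contraction property and the fixed point -/

/-- The hypothesis on `g` lets the smoothing factor `A^{-α}` be moved onto the quadrature operator,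
which bounds the Lipschitz constant of the nonlinear part of the system. -/
theorem norm_discreteG_sub_le {A : X →ₗ.[ℂ] X} {ρ φ α L κ : ℝ} {N n : ℕ} (hn : 1 ≤ n)
    (hκ : 0 ≤ κ) (hL : 0 ≤ L) {g : C(Set.Icc (-1 : ℝ) 1, X) → X}
    (hg : ∀ u v : C(Set.Icc (-1 : ℝ) 1, X),
      ∃ w : X, IsFracPow A α (g u - g v) w ∧ ‖w‖ ≤ L * ‖u - v‖)
    (hT : ∀ i : Fin (n + 1), ‖sincExp A ρ φ α N (node n i) ∘L fracPowNeg A α‖ ≤ κ)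
    (x y : Fin (n + 1) → X) :
    ‖discreteG A ρ φ α N n g x - discreteG A ρ φ α N n g y‖ ≤ κ * L * ‖x - y‖ := by
  refine (pi_norm_le_iff_of_nonneg (by positivity)).2 fun i => ?_
  obtain ⟨w, hw, hwL⟩ := hg (hermiteFejer n x) (hermiteFejer n y)
  have hw' : fracPowNeg A α w = g (hermiteFejer n x) - g (hermiteFejer n y) := hw
  have hle : ‖hermiteFejer n x - hermiteFejer n y‖ ≤ ‖x - y‖ := by
    rw [hermiteFejer_sub]
    exact norm_hermiteFejer_le hn _
  calc ‖(discreteG A ρ φ α N n g x - discreteG A ρ φ α N n g y) i‖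
      = ‖(sincExp A ρ φ α N (node n i) ∘L fracPowNeg A α) w‖ := by
        simp only [discreteG, Pi.sub_apply, ← map_sub, ContinuousLinearMap.comp_apply, hw']
    _ ≤ κ * ‖w‖ := ContinuousLinearMap.le_of_opNorm_le _ (hT i) w
    _ ≤ κ * (L * ‖x - y‖) :=
        mul_le_mul_of_nonneg_left (hwL.trans (mul_le_mul_of_nonneg_left hle hL)) hκ
    _ = κ * L * ‖x - y‖ := (mul_assoc _ _ _).symm

theorem iterate_eq {V : Type*} [Add V] (G : V → V) (p : V) (k : ℕ) :
    iterate G p k = (fun y => G y + p)^[k] p := by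
  induction k with
  | zero => rfl
  | succ k ih => rw [Function.iterate_succ_apply', ← ih, iterate]

/-- Banach's fixed-point theorem for `y ↦ G y + p`, with the iteration started at `p`. -/
theorem exists_solution_of_contraction {V : Type*} [NormedAddCommGroup V] [CompleteSpace V]
    {G : V → V} {q : ℝ} (hq0 : 0 ≤ q) (hq1 : q < 1)
    (hG : ∀ x y, ‖G x - G y‖ ≤ q * ‖x - y‖) (p : V) :
    ∃ y : V, y = G y + p ∧ (∀ x : V, x = G x + p → x = y) ∧
      Filter.Tendsto (iterate G p) Filter.atTop (nhds y) ∧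
      ‖y‖ ≤ ‖p‖ + ‖G p‖ * (1 / (1 - q)) ∧
      ∀ k : ℕ, ‖y - iterate G p k‖ ≤ ‖G p‖ * (q ^ k / (1 - q)) := by
  have hF : ContractingWith ⟨q, hq0⟩ fun y => G y + p := by
    refine ⟨by exact_mod_cast hq1, LipschitzWith.of_dist_le_mul fun x y => ?_⟩
    rw [dist_add_right, dist_eq_norm, dist_eq_norm]
    exact hG x y
  have hiter : iterate G p = fun k => (fun y => G y + p)^[k] p := funext (iterate_eq G p)
  have hest : ∀ k : ℕ,
      ‖hF.fixedPoint - iterate G p k‖ ≤ ‖G p‖ * (q ^ k / (1 - q)) := by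
    intro k
    have h := hF.apriori_dist_iterate_fixedPoint_le p k
    rw [dist_comm, dist_eq_norm, dist_eq_norm, sub_add_cancel_right, norm_neg, mul_div_assoc] at h
    rw [iterate_eq]
    exact h
  refine ⟨hF.fixedPoint, hF.fixedPoint_isFixedPt.symm, fun x hx => hF.fixedPoint_unique hx.symm,
    hiter ▸ hF.tendsto_iterate_fixedPoint p, ?_, hest⟩
  have h0 := hest 0
  rw [pow_zero] at h0
  exact (norm_le_insert' _ _).trans (add_le_add_right h0 ‖p‖)

end Scheme

end NonlocalCauchy

end

theorem theorem2 {X : Type*} [NormedAddCommGroup X] [NormedSpace ℂ X] [CompleteSpace X]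
    (A : X →ₗ.[ℂ] X) (hdense : Dense (A.domain : Set X))
    (ρ φ : ℝ) (hA : NonlocalCauchy.IsSectorial A ρ φ)
    (g : C(Set.Icc (-1 : ℝ) 1, X) → X) (u₀ : X)
    (α L c : ℝ) (hα : 0 < α) (hL : 0 < L) (hc : 0 < c)
    -- `‖A^α (g(u) - g(v))‖ ≤ L max_t ‖u(t) - v(t)‖`
    (hg : ∀ u v : C(Set.Icc (-1 : ℝ) 1, X),
      ∃ w : X, NonlocalCauchy.IsFracPow A α (g u - g v) w ∧ ‖w‖ ≤ L * ‖u - v‖)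
    (n N : ℕ) (hn : 1 ≤ n)
    -- `c` is a constant with `‖T_N(A, t_i) A^{-α}‖ ≤ c / α`
    (hT : ∀ i : Fin (n + 1),
      ‖NonlocalCauchy.sincExp A ρ φ α N (NonlocalCauchy.node n i) ∘L
        NonlocalCauchy.fracPowNeg A α‖ ≤ c / α)
    (q : ℝ) (hq : q = 3 * L * c / α) (hq1 : q < 1)
    (G : (Fin (n + 1) → X) → (Fin (n + 1) → X))
    (hG : G = NonlocalCauchy.discreteG A ρ φ α N n g)
    (p : Fin (n + 1) → X) (hp : p = NonlocalCauchy.discreteP A ρ φ α N n u₀) :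
    ∃ y : Fin (n + 1) → X,
      y = G y + p ∧
      (∀ x : Fin (n + 1) → X, x = G x + p → x = y) ∧
      Filter.Tendsto (NonlocalCauchy.iterate G p) Filter.atTop (nhds y) ∧
      ‖y‖ ≤ ‖p‖ + ‖G p‖ * (1 / (1 - q)) ∧
      ∀ k : ℕ, ‖y - NonlocalCauchy.iterate G p k‖ ≤ ‖G p‖ * (q ^ k / (1 - q)) := by
  subst hG hp
  refine NonlocalCauchy.exists_solution_of_contraction (by rw [hq]; positivity) hq1
    (fun x y => ?_) _
  refine (NonlocalCauchy.norm_discreteG_sub_le hn (by positivity) hL.le hg hT x y).trans ?_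
  -- The Lebesgue constant is `1`, so the factor `3` in `q` leaves room to spare.
  refine mul_le_mul_of_nonneg_right ?_ (norm_nonneg _)
  have h : 0 ≤ L * c / α := by positivity
  calc c / α * L = L * c / α := by ring
    _ ≤ 3 * (L * c / α) := by linarith
    _ = q := by rw [hq]; ring
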